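/- Let $1\le s_1\le n_1$, $1\le s_2\le n_2$ and $m\ge 0$ be integers. Let $X=uv^*\in\mathbb C^{n_1\times n_2}$, where $u\in\mathbb C^{n_1}$ and $v\in\mathbb C^{n_2}$ are independent random unit vectors distributed as follows: the support of $u$ is uniformly distributed over the subsets of $\{1,\dots,n_1\}$ of cardinality $s_1$ and, given the support, the restriction of $u$ to its support is uniformly distributed on the unit sphere of $\mathbb C^{s_1}$; $v$ is distributed in the same way with $(n_2,s_2)$ in place of $(n_1,s_1)$. For $\sigma>0$ let $Z\sim\mathcal{CN}(0,\sigma^2I_m)$ be independent of $X$ (the real and imaginary parts of $Z$ are independent, each with law $\mathcal N(0,\frac{\sigma^2}{2}I_m)$). An encoder is a measurable map $f:\mathbb C^{n_1\times n_2}\to\mathbb C^m$ with $\mathbb E\|f(X)\|_2^2\le m$, a decoder is a measurable map $g:\mathbb C^m\to\mathbb C^{n_1\times n_2}$, and $\hat X=g(f(X)+Z)$. Logarithms are natural. (i) Let $\sigma>0$ and $0<D<\frac1{12}$. If an encoder $f$ and a decoder $g$ satisfy $\mathbb E\|\hat X-X\|_F^2\le D$, then $$m\ \ge\ \frac{(s_1+s_2-2)\log\frac1{12D}-7}{\log\left(1+\frac1{\sigma^2}\right)}.$$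 (ii) In particular, if there is a constant $C$ such that for every $\sigma>0$ there are an encoder and a decoder (which may both depend on $\sigma$) with $\mathbb E\|\hat X-X\|_F^2\le C\sigma^2$, then $m\ge s_1+s_2-2$. -/

import Mathlib

open MeasureTheory ProbabilityTheory
open scoped ENNReal

-- Matrix norms below are Frobenius norms.
attribute [local instance] Matrix.frobeniusNormedAddCommGroup

noncomputable section

namespace SparseRankOne

/-- Complex matrices carry the entrywise (equivalently, Borel) σ-algebra. -/
instance instMeasurableSpaceMatrix (n₁ n₂ : ℕ) :
    MeasurableSpace (Matrix (Fin n₁) (Fin n₂) ℂ) :=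
  inferInstanceAs (MeasurableSpace (Fin n₁ → Fin n₂ → ℂ))

/-- The uniform probability distribution on the unit sphere of `ℂ^ι`, i.e. normalized surface
measure, regarded as a measure on `ℂ^ι` (for nonempty `ι`). -/
def uniformSphere (ι : Type) [Fintype ι] : Measure (EuclideanSpace ℂ ι) :=
  (((volume : Measure (EuclideanSpace ℂ ι)).toSphere Set.univ)⁻¹ •
    (volume : Measure (EuclideanSpace ℂ ι)).toSphere).map Subtype.val

/-- Extension by zero of a vector indexed by `S ⊆ [n]` to a vector of `ℂ^n`. -/
def zeroExtend {n : ℕ} (S : Finset (Fin n)) (x : EuclideanSpace ℂ S) :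
    EuclideanSpace ℂ (Fin n) :=
  WithLp.toLp 2 fun i => if h : i ∈ S then x ⟨i, h⟩ else 0

/-- The law of a random `s`-sparse unit vector of `ℂ^n`: the support `S` is uniform among the
subsets of `[n]` of cardinality `s`, and, given `S`, the restriction to `S` is uniform on the unit
sphere of `ℂ^S`. -/
def sparseUnitLaw (n s : ℕ) : Measure (EuclideanSpace ℂ (Fin n)) :=
  ((n.choose s : ℝ≥0∞))⁻¹ •
    ∑ S ∈ (Finset.univ : Finset (Fin n)).powersetCard s, (uniformSphere S).map (zeroExtend S)

/-- The rank-one matrix `u v^*`. -/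
def outer {n₁ n₂ : ℕ} (u : EuclideanSpace ℂ (Fin n₁)) (v : EuclideanSpace ℂ (Fin n₂)) :
    Matrix (Fin n₁) (Fin n₂) ℂ :=
  Matrix.vecMulVec (fun i => u i) (star fun j => v j)

/-- The law of the signal `X = u v^*`, with `u` and `v` independent random sparse unit vectors. -/
def signalLaw (n₁ n₂ s₁ s₂ : ℕ) : Measure (Matrix (Fin n₁) (Fin n₂) ℂ) :=
  ((sparseUnitLaw n₁ s₁).prod (sparseUnitLaw n₂ s₂)).map fun p => outer p.1 p.2

/-- The scalar law `CN(0, σ²)`: independent real and imaginary parts, each `N(0, σ²/2)`. -/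
def complexGaussian (σ : ℝ) : Measure ℂ :=
  ((gaussianReal 0 (σ ^ 2 / 2).toNNReal).prod (gaussianReal 0 (σ ^ 2 / 2).toNNReal)).map
    fun p => (⟨p.1, p.2⟩ : ℂ)

/-- The noise law `CN(0, σ² I_m)` on `ℂ^m`. -/
def noiseLaw (m : ℕ) (σ : ℝ) : Measure (EuclideanSpace ℂ (Fin m)) :=
  (Measure.pi fun _ : Fin m => complexGaussian σ).map (WithLp.toLp 2)

/-- The average power `E ‖f(X)‖²` of an encoder `f`. -/
def avgPower {n₁ n₂ m : ℕ} (s₁ s₂ : ℕ)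
    (f : Matrix (Fin n₁) (Fin n₂) ℂ → EuclideanSpace ℂ (Fin m)) : ℝ≥0∞ :=
  ∫⁻ X, ‖f X‖ₑ ^ 2 ∂(signalLaw n₁ n₂ s₁ s₂)

/-- The mean square error `E ‖X̂ - X‖_F²` of `X̂ = g(f(X) + Z)`, with `Z ∼ CN(0, σ² I_m)`
independent of `X`. -/
def meanSqError {n₁ n₂ m : ℕ} (s₁ s₂ : ℕ) (σ : ℝ)
    (f : Matrix (Fin n₁) (Fin n₂) ℂ → EuclideanSpace ℂ (Fin m))
    (g : EuclideanSpace ℂ (Fin m) → Matrix (Fin n₁) (Fin n₂) ℂ) : ℝ≥0∞ :=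
  ∫⁻ p, ‖g (f p.1 + p.2) - p.1‖ₑ ^ 2 ∂((signalLaw n₁ n₂ s₁ s₂).prod (noiseLaw m σ))

end SparseRankOne

end

/-! The proof is a rate-distortion converse: the information carried by the Gaussian channel, at
most m log(1 + 1/σ²), must exceed a Shannon lower bound for the source. It is run in dual form,
without mutual information.

Compare the joint law P of signal and noise with a reference in which the output is independent of X
and has law CN(0, τ²I), τ² = 1 + σ². Let E be the likelihood ratio of the reference to P, times
exp(-r‖X̂ - X‖²). Under the reference, X̂ is frozen when X is averaged, so the P-mean of E is at
most any bound B for E exp(-r‖M - X‖²) uniform in the matrix M (`lintegral_likelihood_mul_le`).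
Integrating log(E/B) ≤ E/B - 1, where the power constraint makes the quadratic terms nonnegative in
mean, gives -rD - log B ≤ m log(1 + 1/σ²) (`capacity_ge`).

The source enters only through B (`lintegral_signalLaw_exp_le`). Replacing M by its nearest unit
rank-one matrix ab* costs a factor 4 in r, and the squared distance from uv* to ab* dominates the
sum of the squared distances of u and v to the lines of a and b. By independence it remains to bound
a Laplace transform on one sphere (`lintegral_uniformSphere_exp_le`). There are s - 1 complex
directions transverse to a line, each contributing 1/b, whence the exponent s₁ + s₂ - 2. Taking r =
(s₁ + s₂ - 2)/D gives (i); letting σ tend to 0 and comparing the coefficients of log(1/σ²) gives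
(ii). -/

namespace SparseRankOne

/-! ### Gaussian integrals and Lebesgue measure on `ℂ^ι` -/

/-- Tonelli's theorem for a product of functions of the separate coordinates. -/
theorem lintegral_ofReal_prod {ι : Type*} [Fintype ι] {f : ι → ℂ → ℝ}
    (hf : ∀ i z, 0 ≤ f i z) (hi : ∀ i, Integrable (f i)) :
    ∫⁻ x : ι → ℂ, ∏ i, ENNReal.ofReal (f i (x i)) = ∏ i, ∫⁻ z, ENNReal.ofReal (f i z) := by
  simp_rw [← ENNReal.ofReal_prod_of_nonneg fun i _ => hf i _]
  rw [← ofReal_integral_eq_lintegral_ofReal (volume_pi (α := fun _ : ι => ℂ) ▸ Integrable.fintype_prod hi)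
    (.of_forall fun x => Finset.prod_nonneg fun i _ => hf i _),
    integral_fintype_prod_volume_eq_prod,
    ENNReal.ofReal_prod_of_nonneg fun i _ => integral_nonneg (hf i)]
  exact Finset.prod_congr rfl fun i _ =>
    ofReal_integral_eq_lintegral_ofReal (hi i) (.of_forall (hf i))

theorem integral_exp_neg_mul_sq_norm_complex {b : ℝ} (hb : 0 < b) :
    ∫ z : ℂ, Real.exp (-b * ‖z‖ ^ 2) = Real.pi / b := by
  rw [GaussianFourier.integral_rexp_neg_mul_sq_norm hb, Complex.finrank_real_complex]
  norm_num

theorem integrable_exp_neg_mul_sq_norm_complex {b : ℝ} (hb : 0 < b) :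
    Integrable fun z : ℂ => Real.exp (-b * ‖z‖ ^ 2) := by
  apply Integrable.of_integral_ne_zero
  rw [integral_exp_neg_mul_sq_norm_complex hb]
  positivity

theorem finrank_real_euclideanSpace_complex (ι : Type*) [Fintype ι] :
    Module.finrank ℝ (EuclideanSpace ℂ ι) = 2 * Fintype.card ι := by
  rw [← Module.finrank_mul_finrank ℝ ℂ, Complex.finrank_real_complex, finrank_euclideanSpace]

/-- The Lebesgue measure of the Hermitian space `ℂ^ι` is the product measure. -/
theorem map_toLp_volume (ι : Type*) [Fintype ι] [Nonempty ι] :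
    (volume : Measure (ι → ℂ)).map (WithLp.toLp 2) = (volume : Measure (EuclideanSpace ℂ ι)) := by
  have hH : ((volume : Measure (ι → ℂ)).map (WithLp.toLp 2) :
      Measure (EuclideanSpace ℂ ι)).IsAddHaarMeasure :=
    (PiLp.continuousLinearEquiv 2 ℝ (fun _ : ι => ℂ)).symm.isAddHaarMeasure_map volume
  have hm : Measurable (WithLp.toLp 2 : (ι → ℂ) → EuclideanSpace ℂ ι) := by fun_prop
  -- Both measures are Haar, so only a constant is in question. The unit ball fixes it: both give it
  -- volume π^n/n!.
  have hball : (volume : Measure (ι → ℂ)).map (WithLp.toLp 2)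
      (Metric.ball (0 : EuclideanSpace ℂ ι) 1) = volume (Metric.ball (0 : EuclideanSpace ℂ ι) 1) := by
    rw [Measure.map_apply hm measurableSet_ball,
      InnerProductSpace.volume_ball_of_dim_even (finrank_real_euclideanSpace_complex ι)]
    have := Complex.volume_sum_rpow_lt_one ι (p := 2) (by norm_num)
    convert this using 2
    · ext x
      simp [EuclideanSpace.norm_eq, Real.sqrt_lt' zero_lt_one]
    · norm_num
      simp [Real.Gamma_nat_eq_factorial]
  have h := Measure.isAddLeftInvariant_eq_smul ((volume : Measure (ι → ℂ)).map (WithLp.toLp 2))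
    (volume : Measure (EuclideanSpace ℂ ι))
  rw [h, Measure.smul_apply] at hball
  rw [h]
  have h0 : (volume (Metric.ball (0 : EuclideanSpace ℂ ι) 1)) ≠ 0 :=
    (Metric.measure_ball_pos _ _ one_pos).ne'
  have h1 : (volume (Metric.ball (0 : EuclideanSpace ℂ ι) 1)) ≠ ⊤ := measure_ball_lt_top.ne
  set c := Measure.addHaarScalarFactor ((volume : Measure (ι → ℂ)).map (WithLp.toLp 2))
    (volume : Measure (EuclideanSpace ℂ ι))
  have hc : (c : ℝ≥0∞) = 1 := by
    rw [ENNReal.smul_def, smul_eq_mul] at hball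
    exact (ENNReal.mul_left_inj h0 h1).1 (by rw [hball, one_mul])
  rw [ENNReal.coe_eq_one.1 hc, one_smul]

/-! ### Laplace transforms on the complex sphere -/

/-- A function on the sphere is dominated in mean by a function on the ball which is larger along
each radius. -/
theorem lintegral_toSphere_le {E : Type*} [NormedAddCommGroup E] [NormedSpace ℝ E]
    [MeasurableSpace E] [BorelSpace E] [FiniteDimensional ℝ E] [Nontrivial E]
    (ν : Measure E) [ν.IsAddHaarMeasure] {h : E → ℝ≥0∞} (hh : Measurable h)
    (hr : ∀ x : E, ‖x‖ = 1 → ∀ r : ℝ, 0 < r → r < 1 → h x ≤ h (r • x)) :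
    ∫⁻ x, h x ∂(ν.toSphere.map Subtype.val) ≤
      Module.finrank ℝ E * ∫⁻ x in Metric.ball 0 1, h x ∂ν := by
  set d := Module.finrank ℝ E with hd
  have hdpos : 0 < d := Module.finrank_pos
  rw [lintegral_map hh measurable_subtype_coe]
  let one : Set.Ioi (0 : ℝ) := ⟨1, Set.mem_Ioi.2 one_pos⟩
  have hmp := (Measure.measurePreserving_homeomorphUnitSphereProd ν).symm
    (homeomorphUnitSphereProd E).toMeasurableEquiv
  have hG : Measurable ((Metric.ball (0 : E) 1).indicator h) := hh.indicator measurableSet_ball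
  -- Polar coordinates; removing the origin costs nothing.
  have key : ∫⁻ x in Metric.ball 0 1, h x ∂ν =
      ∫⁻ p : Metric.sphere (0 : E) 1 × Set.Ioi (0 : ℝ),
        (Metric.ball (0 : E) 1).indicator h ((p.2 : ℝ) • (p.1 : E))
          ∂(ν.toSphere.prod (Measure.volumeIoiPow (d - 1))) := by
    rw [← lintegral_indicator measurableSet_ball]
    have h1 : ∫⁻ x, (Metric.ball (0 : E) 1).indicator h x ∂ν =
        ∫⁻ x in ({0}ᶜ : Set E), (Metric.ball (0 : E) 1).indicator h x ∂ν := by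
      rw [restrict_compl_singleton]
    rw [h1, ← lintegral_subtype_comap (measurableSet_singleton (0 : E)).compl]
    exact (hmp.lintegral_comp (hG.comp measurable_subtype_coe)).symm
  rw [key, lintegral_prod _ (by
    apply Measurable.aemeasurable
    apply hG.comp
    fun_prop)]
  rw [← lintegral_const_mul' _ _ (by simp)]
  apply lintegral_mono
  intro θ
  have hθ : ‖(θ : E)‖ = 1 := by simp
  -- The radial weight r^(d-1) has mass 1/d on (0, 1), which the factor d normalizes.
  calc h θ = d * ∫⁻ r in Set.Iio one, h θ ∂(Measure.volumeIoiPow (d - 1)) := by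
        rw [setLIntegral_const, Measure.volumeIoiPow_apply_Iio]
        have : ((d - 1 : ℕ) : ℝ) + 1 = d := by
          rw [← Nat.cast_add_one, Nat.sub_add_cancel hdpos]
        rw [this]
        have h2 : ENNReal.ofReal ((one : ℝ) ^ (d - 1 + 1) / d) = (d : ℝ≥0∞)⁻¹ := by
          simp only [one, one_pow, one_div]
          rw [ENNReal.ofReal_inv_of_pos (by exact_mod_cast hdpos), ENNReal.ofReal_natCast]
        rw [h2, mul_comm, mul_assoc, ENNReal.inv_mul_cancel (by simp [hdpos.ne']) (by simp), mul_one]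
    _ ≤ d * ∫⁻ r, (Metric.ball (0 : E) 1).indicator h ((r : ℝ) • (θ : E))
          ∂(Measure.volumeIoiPow (d - 1)) := by
        rw [← lintegral_indicator measurableSet_Iio]
        refine mul_le_mul' le_rfl (lintegral_mono fun r => ?_)
        by_cases hr1 : r < one
        · have hr2 : (r : ℝ) < 1 := hr1
          have hr0 : 0 < (r : ℝ) := r.2
          have : (r : ℝ) • (θ : E) ∈ Metric.ball (0 : E) 1 := by
            simp [norm_smul, hθ, abs_of_pos hr0, hr2]
          simp only [Set.indicator, Set.mem_Iio, hr1, if_true, this]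
          exact hr _ hθ _ hr0 hr2
        · simp [Set.indicator, hr1]

/-- A Gaussian integral over the unit ball of `ℂ^ι`, with no decay in the direction `e`. -/
theorem setLIntegral_ball_exp_le {ι : Type} [Fintype ι] [Nonempty ι] {b : ℝ} (hb : 0 < b)
    (e : EuclideanSpace ℂ ι) (he : ‖e‖ = 1) :
    ∫⁻ x in Metric.ball (0 : EuclideanSpace ℂ ι) 1,
        ENNReal.ofReal (Real.exp (-b * (‖x‖ ^ 2 - ‖inner ℂ e x‖ ^ 2))) ≤
      ENNReal.ofReal (Real.pi * (Real.pi / b) ^ (Fintype.card ι - 1)) := by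
  classical
  obtain ⟨i₀⟩ := ‹Nonempty ι›
  have : Nonempty ι := ⟨i₀⟩
  have hon : Orthonormal ℂ (Set.domRestrict ({i₀} : Set ι) (fun _ : ι => e)) := by
    constructor
    · intro i; simpa using he
    · intro i j hij
      exact absurd (Subsingleton.elim i j) hij
  -- Rotate `e` to the coordinate vector `i₀`. Coordinates in `B` form a real-linear isometry, so
  -- volume is preserved.
  obtain ⟨B, hB⟩ := hon.exists_orthonormalBasis_extension_of_card_eq (by simp)
  have hBe : B i₀ = e := hB i₀ rfl
  let T : EuclideanSpace ℂ ι ≃ₗᵢ[ℝ] EuclideanSpace ℂ ι :=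
    { B.repr.toLinearEquiv.restrictScalars ℝ with norm_map' := B.repr.norm_map }
  have hT : ∀ x i, T x i = inner ℂ (B i) x := fun x i => B.repr_apply_apply x i
  let F : EuclideanSpace ℂ ι → ℝ≥0∞ := fun y => (Metric.ball (0 : EuclideanSpace ℂ ι) 1).indicator
    (fun y => ENNReal.ofReal (Real.exp (-b * (‖y‖ ^ 2 - ‖y i₀‖ ^ 2)))) y
  have hF : Measurable F := by
    refine Measurable.indicator ?_ measurableSet_ball
    fun_prop
  have h1 : ∫⁻ x in Metric.ball (0 : EuclideanSpace ℂ ι) 1,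
      ENNReal.ofReal (Real.exp (-b * (‖x‖ ^ 2 - ‖inner ℂ e x‖ ^ 2))) = ∫⁻ x, F (T x) := by
    rw [← lintegral_indicator measurableSet_ball]
    refine lintegral_congr fun x => ?_
    simp only [F, Set.indicator, mem_ball_zero_iff, T.norm_map, hT, hBe]
  -- Product majorant: the ball is relaxed to the unit disc in coordinate `i₀`, of area π, and to
  -- all of ℂ in the others, each giving π/b.
  let f : ι → ℂ → ℝ := fun i z =>
    if i = i₀ then (Metric.ball (0 : ℂ) 1).indicator 1 z else Real.exp (-b * ‖z‖ ^ 2)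
  have hf0 : ∀ i z, 0 ≤ f i z := by
    intro i z
    simp only [f]
    split_ifs
    · exact Set.indicator_nonneg (by simp) _
    · positivity
  have hfi : ∀ i, Integrable (f i) := by
    intro i
    by_cases hi : i = i₀
    · simp only [f, hi, if_true]
      exact (integrable_indicator_iff measurableSet_ball).2
        (integrableOn_const measure_ball_lt_top.ne)
    · simp only [f, hi, if_false]
      exact integrable_exp_neg_mul_sq_norm_complex hb
  rw [h1, T.measurePreserving.lintegral_comp hF, ← map_toLp_volume,
    lintegral_map hF (by fun_prop)]
  calc ∫⁻ x : ι → ℂ, F (WithLp.toLp 2 x) ≤ ∫⁻ x : ι → ℂ, ∏ i, ENNReal.ofReal (f i (x i)) := by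
        refine lintegral_mono fun x => ?_
        simp only [F]
        by_cases hx : (WithLp.toLp 2 x : EuclideanSpace ℂ ι) ∈ Metric.ball 0 1
        swap
        · rw [Set.indicator_of_notMem hx]
          exact zero_le
        rw [Set.indicator_of_mem hx]
        rw [← ENNReal.ofReal_prod_of_nonneg fun i _ => hf0 i _]
        refine ENNReal.ofReal_le_ofReal (le_of_eq ?_)
        have hx0 : ‖x i₀‖ < 1 :=
          (PiLp.norm_apply_le (WithLp.toLp 2 x : EuclideanSpace ℂ ι) i₀).trans_lt
            (mem_ball_zero_iff.1 hx)
        rw [EuclideanSpace.norm_sq_eq, ← Finset.add_sum_erase _ _ (Finset.mem_univ i₀),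
          ← Finset.mul_prod_erase _ _ (Finset.mem_univ i₀), add_sub_cancel_left, Finset.mul_sum,
          Real.exp_sum]
        simp only [f, if_true, Set.indicator, mem_ball_zero_iff, hx0, Pi.one_apply, one_mul]
        refine Finset.prod_congr rfl fun i hi => ?_
        rw [if_neg (Finset.ne_of_mem_erase hi)]
    _ = ∏ i, ∫⁻ z, ENNReal.ofReal (f i z) := lintegral_ofReal_prod hf0 hfi
    _ = ENNReal.ofReal (Real.pi * (Real.pi / b) ^ (Fintype.card ι - 1)) := by
        simp_rw [← ofReal_integral_eq_lintegral_ofReal (hfi _) (.of_forall (hf0 _))]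
        rw [← ENNReal.ofReal_prod_of_nonneg fun i _ => integral_nonneg (hf0 i),
          ← Finset.mul_prod_erase _ _ (Finset.mem_univ i₀)]
        congr 2
        · simp only [f, if_true]
          rw [integral_indicator_one measurableSet_ball, Measure.real, Complex.volume_ball]
          simp
        · rw [Finset.prod_congr rfl (g := fun _ => Real.pi / b), Finset.prod_const,
            Finset.card_erase_of_mem (Finset.mem_univ _), Finset.card_univ]
          intro i hi
          simp only [f, if_neg (Finset.ne_of_mem_erase hi)]
          exact integral_exp_neg_mul_sq_norm_complex hb

theorem isProbabilityMeasure_uniformSphere (ι : Type) [Fintype ι] [Nonempty ι] :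
    IsProbabilityMeasure (uniformSphere ι) := by
  constructor
  have h0 : (volume : Measure (EuclideanSpace ℂ ι)).toSphere Set.univ ≠ 0 := by
    rw [Ne, Measure.measure_univ_eq_zero]
    exact Measure.toSphere_ne_zero _
  rw [uniformSphere, Measure.map_apply measurable_subtype_coe MeasurableSet.univ, Set.preimage_univ,
    Measure.smul_apply, smul_eq_mul, ENNReal.inv_mul_cancel h0 (measure_ne_top _ _)]

theorem ae_norm_eq_one_uniformSphere (ι : Type) [Fintype ι] :
    ∀ᵐ x ∂(uniformSphere ι), ‖x‖ = 1 := by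
  rw [uniformSphere, ae_map_iff measurable_subtype_coe.aemeasurable
    (measurableSet_eq_fun measurable_norm measurable_const)]
  exact .of_forall fun x => by simp

/-- Normalizing `a` only enlarges the inner products. The case ‖a‖ < 1, including `a = 0`, arises
when a unit vector is restricted to a support. -/
theorem exists_unit_inner_le {ι : Type} [Fintype ι] [Nonempty ι] (a : EuclideanSpace ℂ ι)
    (ha : ‖a‖ ≤ 1) : ∃ e : EuclideanSpace ℂ ι, ‖e‖ = 1 ∧
      ∀ x, ‖(inner ℂ a x : ℂ)‖ ≤ ‖(inner ℂ e x : ℂ)‖ := by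
  by_cases h : a = 0
  · obtain ⟨e, he⟩ := exists_norm_eq (EuclideanSpace ℂ ι) zero_le_one
    exact ⟨e, he, fun x => by simp [h]⟩
  · have h0 : 0 < ‖a‖ := norm_pos_iff.2 h
    refine ⟨((‖a‖⁻¹ : ℝ) : ℂ) • a, by simp [norm_smul, h0.ne'], fun x => ?_⟩
    rw [inner_smul_left, norm_mul]
    simp only [Complex.conj_ofReal, Complex.norm_real, norm_inv, norm_norm]
    exact le_mul_of_one_le_left (norm_nonneg _) ((one_le_inv₀ h0).2 ha)

/-- Concentration of the uniform law of the sphere: Laplace transform of the squared distance to a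
complex line. -/
theorem lintegral_uniformSphere_exp_le {ι : Type} [Fintype ι] [Nonempty ι] {b : ℝ} (hb : 0 < b)
    (a : EuclideanSpace ℂ ι) (ha : ‖a‖ ≤ 1) :
    ∫⁻ x, ENNReal.ofReal (Real.exp (-b * (1 - ‖(inner ℂ a x : ℂ)‖ ^ 2))) ∂(uniformSphere ι) ≤
      ENNReal.ofReal ((Fintype.card ι).factorial / b ^ (Fintype.card ι - 1)) := by
  obtain ⟨e, he, hae⟩ := exists_unit_inner_le a ha
  -- Writing ‖x‖² for 1 makes the exponent homogeneous of degree 2 and nonpositive, so the function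
  -- increases towards the origin, as the comparison with the ball requires.
  set h : EuclideanSpace ℂ ι → ℝ≥0∞ := fun x =>
    ENNReal.ofReal (Real.exp (-b * (‖x‖ ^ 2 - ‖(inner ℂ e x : ℂ)‖ ^ 2))) with hh
  have hm : Measurable h := by fun_prop
  have hcs : ∀ x, ‖(inner ℂ e x : ℂ)‖ ≤ ‖x‖ := fun x =>
    (norm_inner_le_norm e x).trans (by rw [he, one_mul])
  set s := Fintype.card ι with hs
  have hs0 : 0 < s := Fintype.card_pos
  have hball := InnerProductSpace.volume_ball_of_dim_even
    (finrank_real_euclideanSpace_complex ι) 0 1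
  have hdim := finrank_real_euclideanSpace_complex ι
  calc ∫⁻ x, ENNReal.ofReal (Real.exp (-b * (1 - ‖(inner ℂ a x : ℂ)‖ ^ 2))) ∂(uniformSphere ι)
      ≤ ∫⁻ x, h x ∂(uniformSphere ι) := by
        refine lintegral_mono_ae ?_
        filter_upwards [ae_norm_eq_one_uniformSphere ι] with x hx
        refine ENNReal.ofReal_le_ofReal (Real.exp_le_exp.2 ?_)
        rw [hx]
        have := pow_le_pow_left₀ (norm_nonneg _) (hae x) 2
        nlinarith
    _ = ((volume : Measure (EuclideanSpace ℂ ι)).toSphere Set.univ)⁻¹ *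
          ∫⁻ x, h x ∂((volume : Measure (EuclideanSpace ℂ ι)).toSphere.map Subtype.val) := by
        rw [uniformSphere, Measure.map_smul, lintegral_smul_measure, smul_eq_mul]
    _ ≤ ((volume : Measure (EuclideanSpace ℂ ι)).toSphere Set.univ)⁻¹ *
          (Module.finrank ℝ (EuclideanSpace ℂ ι) *
            ENNReal.ofReal (Real.pi * (Real.pi / b) ^ (s - 1))) := by
        gcongr
        refine (lintegral_toSphere_le volume hm fun x hx r hr0 hr1 => ?_).trans ?_
        · refine ENNReal.ofReal_le_ofReal (Real.exp_le_exp.2 ?_)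
          rw [norm_smul, inner_smul_right_eq_smul, norm_smul, Real.norm_eq_abs, abs_of_pos hr0]
          have h1 : r ^ 2 ≤ 1 := pow_le_one₀ hr0.le hr1.le
          have h2 := pow_le_pow_left₀ (norm_nonneg _) (hcs x) 2
          have h3 := mul_nonneg (mul_nonneg hb.le (sub_nonneg.2 h1)) (sub_nonneg.2 h2)
          nlinarith
        · gcongr
          exact setLIntegral_ball_exp_le hb e he
    -- The sphere has mass 2s · π^s/s!, so the dimension 2s and the powers of π cancel.
    _ = ENNReal.ofReal (s.factorial / b ^ (s - 1)) := by
        rw [Measure.toSphere_apply_univ, hball, hdim, ENNReal.ofReal_one, one_pow, one_mul,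
          ENNReal.mul_inv (.inr ENNReal.ofReal_ne_top)
            (.inr (ENNReal.ofReal_pos.2 (by positivity)).ne'), mul_mul_mul_comm,
          ENNReal.inv_mul_cancel (by simp) (by finiteness), one_mul,
          ← ENNReal.ofReal_inv_of_pos (by positivity), ← ENNReal.ofReal_mul (by positivity)]
        congr 1
        obtain ⟨k, hk⟩ : ∃ k, s = k + 1 := ⟨s - 1, by omega⟩
        rw [← hs, hk]
        simp only [Nat.add_sub_cancel, div_pow]
        field_simp
        ring

/-! ### Sparse unit vectors -/

theorem measurable_zeroExtend {n : ℕ} (S : Finset (Fin n)) : Measurable (zeroExtend S) := by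
  refine (WithLp.measurable_toLp 2 _).comp (measurable_pi_lambda _ fun i => ?_)
  by_cases h : i ∈ S
  · simp only [h, dif_pos]
    fun_prop
  · simp only [h, dif_neg, not_false_eq_true, measurable_const]

theorem sum_zeroExtend {n : ℕ} {M : Type*} [AddCommMonoid M] (S : Finset (Fin n))
    (x : EuclideanSpace ℂ S) (F : Fin n → ℂ → M) (hF : ∀ i, F i 0 = 0) :
    ∑ i, F i (zeroExtend S x i) = ∑ i : S, F i (x i) := by
  rw [← Finset.sum_subset (Finset.subset_univ S), ← Finset.sum_coe_sort S]
  · exact Finset.sum_congr rfl fun i _ => by simp [zeroExtend]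
  · intro i _ hi
    simp [zeroExtend, hi, hF]

theorem norm_zeroExtend {n : ℕ} (S : Finset (Fin n)) (x : EuclideanSpace ℂ S) :
    ‖zeroExtend S x‖ = ‖x‖ := by
  rw [EuclideanSpace.norm_eq, EuclideanSpace.norm_eq,
    sum_zeroExtend S x (fun _ z => ‖z‖ ^ 2) (by simp)]

/-- The restriction of a vector to a set of coordinates. -/
noncomputable def restrictTo {n : ℕ} (S : Finset (Fin n)) (a : EuclideanSpace ℂ (Fin n)) :
    EuclideanSpace ℂ S :=
  WithLp.toLp 2 fun i => a i

theorem norm_restrictTo_le {n : ℕ} (S : Finset (Fin n)) (a : EuclideanSpace ℂ (Fin n)) :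
    ‖restrictTo S a‖ ≤ ‖a‖ := by
  rw [EuclideanSpace.norm_eq, EuclideanSpace.norm_eq]
  refine Real.sqrt_le_sqrt ?_
  simp only [restrictTo]
  rw [Finset.sum_coe_sort S (fun i => ‖a i‖ ^ 2)]
  exact Finset.sum_le_univ_sum_of_nonneg fun i => by positivity

theorem inner_zeroExtend {n : ℕ} (S : Finset (Fin n)) (a : EuclideanSpace ℂ (Fin n))
    (x : EuclideanSpace ℂ S) : (inner ℂ a (zeroExtend S x) : ℂ) = inner ℂ (restrictTo S a) x := by
  rw [PiLp.inner_apply, PiLp.inner_apply, sum_zeroExtend S x (fun i z => inner ℂ (a i) z) (by simp)]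
  rfl

theorem lintegral_sparseUnitLaw {n s : ℕ} {F : EuclideanSpace ℂ (Fin n) → ℝ≥0∞}
    (hF : Measurable F) :
    ∫⁻ u, F u ∂(sparseUnitLaw n s) = (n.choose s : ℝ≥0∞)⁻¹ *
      ∑ S ∈ (Finset.univ : Finset (Fin n)).powersetCard s,
        ∫⁻ x, F (zeroExtend S x) ∂(uniformSphere S) := by
  rw [sparseUnitLaw, lintegral_smul_measure, lintegral_finsetSum_measure, smul_eq_mul]
  congr 1
  exact Finset.sum_congr rfl fun S _ => lintegral_map hF (measurable_zeroExtend S)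

theorem inv_choose_mul_sum_const {n s : ℕ} (h : s ≤ n) (c : ℝ≥0∞) :
    (n.choose s : ℝ≥0∞)⁻¹ * ∑ _S ∈ (Finset.univ : Finset (Fin n)).powersetCard s, c = c := by
  rw [Finset.sum_const, Finset.card_powersetCard, Finset.card_univ, Fintype.card_fin, nsmul_eq_mul,
    ← mul_assoc, ENNReal.inv_mul_cancel (by simpa using (Nat.choose_pos h).ne') (by simp), one_mul]

theorem nonempty_of_mem_powersetCard {n s : ℕ} (hs : 1 ≤ s) {S : Finset (Fin n)}
    (hS : S ∈ (Finset.univ : Finset (Fin n)).powersetCard s) : Nonempty S := by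
  rw [Finset.mem_powersetCard] at hS
  exact (Finset.card_pos.1 (by omega)).to_subtype

theorem isProbabilityMeasure_sparseUnitLaw {n s : ℕ} (hs : 1 ≤ s) (h : s ≤ n) :
    IsProbabilityMeasure (sparseUnitLaw n s) := by
  constructor
  rw [← lintegral_one, lintegral_sparseUnitLaw measurable_const]
  refine Eq.trans ?_ (inv_choose_mul_sum_const h 1)
  congr 1
  refine Finset.sum_congr rfl fun S hS => ?_
  have := nonempty_of_mem_powersetCard hs hS
  have := isProbabilityMeasure_uniformSphere S
  simp

theorem ae_norm_eq_one_sparseUnitLaw (n s : ℕ) : ∀ᵐ u ∂(sparseUnitLaw n s), ‖u‖ = 1 := by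
  have hms : MeasurableSet {u : EuclideanSpace ℂ (Fin n) | ‖u‖ = 1} :=
    measurableSet_eq_fun measurable_norm measurable_const
  refine Measure.ae_smul_measure ?_ _
  rw [← Measure.sum_coe_finset, Measure.ae_sum_iff]
  rintro ⟨S, hS⟩
  rw [ae_map_iff (measurable_zeroExtend S).aemeasurable hms]
  filter_upwards [ae_norm_eq_one_uniformSphere S] with x hx
  rw [norm_zeroExtend, hx]

/-- Given the support S, only the restriction of `a` to S matters. The spherical bound depends on S
only through its cardinality, so it survives averaging over S. -/
theorem lintegral_sparseUnitLaw_exp_le {n s : ℕ} (hs : 1 ≤ s) (h : s ≤ n) {b : ℝ} (hb : 0 < b)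
    (a : EuclideanSpace ℂ (Fin n)) (ha : ‖a‖ ≤ 1) :
    ∫⁻ u, ENNReal.ofReal (Real.exp (-b * (1 - ‖(inner ℂ a u : ℂ)‖ ^ 2))) ∂(sparseUnitLaw n s) ≤
      ENNReal.ofReal (s.factorial / b ^ (s - 1)) := by
  rw [lintegral_sparseUnitLaw (by fun_prop), ← inv_choose_mul_sum_const h (ENNReal.ofReal _)]
  gcongr with S hS
  have := nonempty_of_mem_powersetCard hs hS
  simp_rw [inner_zeroExtend]
  have h1 := lintegral_uniformSphere_exp_le hb (restrictTo S a) ((norm_restrictTo_le S a).trans ha)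
  rwa [Fintype.card_coe, (Finset.mem_powersetCard.1 hS).2] at h1

/-! ### Geometry of unit rank-one matrices and the signal law -/

theorem frobenius_norm_sq {n₁ n₂ : ℕ} (A : Matrix (Fin n₁) (Fin n₂) ℂ) :
    ‖A‖ ^ 2 = ∑ i, ∑ j, ‖A i j‖ ^ 2 := by
  have h0 : 0 ≤ ∑ i, ∑ j, ‖A i j‖ ^ 2 := by positivity
  rw [Matrix.frobenius_norm_def, ← Real.sqrt_eq_rpow]
  simp only [Real.rpow_ofNat]
  exact Real.sq_sqrt h0

theorem outer_apply {n₁ n₂ : ℕ} (u : EuclideanSpace ℂ (Fin n₁)) (v : EuclideanSpace ℂ (Fin n₂))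
    (i : Fin n₁) (j : Fin n₂) : outer u v i j = u i * star (v j) := rfl

theorem measurable_outer {n₁ n₂ : ℕ} :
    Measurable fun p : EuclideanSpace ℂ (Fin n₁) × EuclideanSpace ℂ (Fin n₂) =>
      outer p.1 p.2 := by
  refine measurable_pi_lambda _ fun i => measurable_pi_lambda _ fun j => ?_
  simp only [outer_apply, RCLike.star_def]
  fun_prop

theorem measurable_frobenius_norm_sq {n₁ n₂ : ℕ} {α : Type*} [MeasurableSpace α]
    {F : α → Matrix (Fin n₁) (Fin n₂) ℂ} (hF : Measurable F) : Measurable fun x => ‖F x‖ ^ 2 := by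
  simp_rw [frobenius_norm_sq]
  refine Finset.measurable_sum _ fun i _ => Finset.measurable_sum _ fun j _ => ?_
  have : Measurable fun x => F x i j :=
    (measurable_pi_apply j).comp ((measurable_pi_apply i).comp hF)
  fun_prop

theorem measurable_matrix_sub {n₁ n₂ : ℕ} {α : Type*} [MeasurableSpace α]
    {F G : α → Matrix (Fin n₁) (Fin n₂) ℂ} (hF : Measurable F) (hG : Measurable G) :
    Measurable fun x => F x - G x := by
  refine measurable_pi_lambda _ fun i => measurable_pi_lambda _ fun j => ?_
  have h1 : Measurable fun x => F x i j :=
    (measurable_pi_apply j).comp ((measurable_pi_apply i).comp hF)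
  have h2 : Measurable fun x => G x i j :=
    (measurable_pi_apply j).comp ((measurable_pi_apply i).comp hG)
  exact h1.sub h2

theorem norm_outer_sub_outer_sq {n₁ n₂ : ℕ} {u a : EuclideanSpace ℂ (Fin n₁)}
    {v b : EuclideanSpace ℂ (Fin n₂)} (hu : ‖u‖ = 1) (ha : ‖a‖ = 1) (hv : ‖v‖ = 1) (hb : ‖b‖ = 1) :
    ‖outer u v - outer a b‖ ^ 2 =
      2 - 2 * ((inner ℂ a u : ℂ) * star (inner ℂ b v : ℂ)).re := by
  have hsum : ∀ (x : EuclideanSpace ℂ (Fin n₁)) (y : EuclideanSpace ℂ (Fin n₂)),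
      ∑ i, ∑ j, ‖x i * star (y j)‖ ^ 2 = ‖x‖ ^ 2 * ‖y‖ ^ 2 := by
    intro x y
    rw [EuclideanSpace.norm_sq_eq, EuclideanSpace.norm_sq_eq, Finset.sum_mul_sum]
    simp [mul_pow]
  have hin : ∑ i, ∑ j, (u i * star (v j) * star (a i * star (b j))) =
      (inner ℂ a u : ℂ) * star (inner ℂ b v : ℂ) := by
    rw [PiLp.inner_apply, PiLp.inner_apply, star_sum, Finset.sum_mul_sum]
    refine Finset.sum_congr rfl fun i _ => Finset.sum_congr rfl fun j _ => ?_
    simp only [RCLike.inner_apply, star_mul, RCLike.star_def, RCLike.conj_conj]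
    ring
  rw [frobenius_norm_sq]
  have hpt : ∀ i j, ‖(outer u v - outer a b) i j‖ ^ 2 = ‖u i * star (v j)‖ ^ 2 +
      ‖a i * star (b j)‖ ^ 2 - 2 * (u i * star (v j) * star (a i * star (b j))).re := by
    intro i j
    rw [Matrix.sub_apply, outer_apply, outer_apply, ← Complex.normSq_eq_norm_sq, Complex.normSq_sub,
      Complex.normSq_eq_norm_sq, Complex.normSq_eq_norm_sq]
    rfl
  simp_rw [hpt, Finset.sum_sub_distrib, Finset.sum_add_distrib, ← Finset.mul_sum, hsum,
    ← Complex.re_sum, hin, hu, hv, ha, hb]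
  norm_num

/-- With α, β the two inner products, the right side is 2 - 2 Re(αβ̄) ≥ 2 - 2|α||β| ≥ 2 - |α|² -
|β|². This separates u from v, so that independence can be used. -/
theorem le_norm_outer_sub_outer_sq {n₁ n₂ : ℕ} {u a : EuclideanSpace ℂ (Fin n₁)}
    {v b : EuclideanSpace ℂ (Fin n₂)} (hu : ‖u‖ = 1) (ha : ‖a‖ = 1) (hv : ‖v‖ = 1) (hb : ‖b‖ = 1) :
    (1 - ‖(inner ℂ a u : ℂ)‖ ^ 2) + (1 - ‖(inner ℂ b v : ℂ)‖ ^ 2) ≤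
      ‖outer u v - outer a b‖ ^ 2 := by
  rw [norm_outer_sub_outer_sq hu ha hv hb]
  have h := Complex.re_le_norm ((inner ℂ a u : ℂ) * star (inner ℂ b v : ℂ))
  rw [norm_mul, norm_star] at h
  nlinarith [sq_nonneg (‖(inner ℂ a u : ℂ)‖ - ‖(inner ℂ b v : ℂ)‖)]

/-- Every matrix has a best approximation among the matrices `a b^*` with unit vectors `a`, `b`. -/
theorem exists_nearest_outer {n₁ n₂ : ℕ} (h₁ : 1 ≤ n₁) (h₂ : 1 ≤ n₂)
    (M : Matrix (Fin n₁) (Fin n₂) ℂ) :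
    ∃ (a : EuclideanSpace ℂ (Fin n₁)) (b : EuclideanSpace ℂ (Fin n₂)), ‖a‖ = 1 ∧ ‖b‖ = 1 ∧
      ∀ u v, ‖u‖ = 1 → ‖v‖ = 1 → ‖outer a b - M‖ ≤ ‖outer u v - M‖ := by
  have : Nonempty (Fin n₁) := ⟨⟨0, h₁⟩⟩
  have : Nonempty (Fin n₂) := ⟨⟨0, h₂⟩⟩
  have hc : Continuous fun p : EuclideanSpace ℂ (Fin n₁) × EuclideanSpace ℂ (Fin n₂) =>
      ‖outer p.1 p.2 - M‖ ^ 2 := by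
    simp_rw [frobenius_norm_sq, Matrix.sub_apply, outer_apply]
    fun_prop
  obtain ⟨p, hp, hmin⟩ := ((isCompact_sphere (0 : EuclideanSpace ℂ (Fin n₁)) 1).prod
    (isCompact_sphere (0 : EuclideanSpace ℂ (Fin n₂)) 1)).exists_isMinOn
      ((NormedSpace.sphere_nonempty.2 zero_le_one).prod (NormedSpace.sphere_nonempty.2 zero_le_one))
      hc.continuousOn
  refine ⟨p.1, p.2, by simpa using hp.1, by simpa using hp.2, fun u v hu hv => ?_⟩
  have h := hmin (a := (u, v)) (by simp [hu, hv])
  exact (pow_le_pow_iff_left₀ (norm_nonneg _) (norm_nonneg _) two_ne_zero).1 h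

theorem isProbabilityMeasure_signalLaw {n₁ n₂ s₁ s₂ : ℕ}
    (hs₁ : 1 ≤ s₁) (hsn₁ : s₁ ≤ n₁) (hs₂ : 1 ≤ s₂) (hsn₂ : s₂ ≤ n₂) :
    IsProbabilityMeasure (signalLaw n₁ n₂ s₁ s₂) := by
  have := isProbabilityMeasure_sparseUnitLaw hs₁ hsn₁
  have := isProbabilityMeasure_sparseUnitLaw hs₂ hsn₂
  exact Measure.isProbabilityMeasure_map measurable_outer.aemeasurable

/-- No matrix is close to the random signal with large probability. -/
theorem lintegral_signalLaw_exp_le {n₁ n₂ s₁ s₂ : ℕ}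
    (hs₁ : 1 ≤ s₁) (hsn₁ : s₁ ≤ n₁) (hs₂ : 1 ≤ s₂) (hsn₂ : s₂ ≤ n₂) {r : ℝ} (hr : 0 < r)
    (M : Matrix (Fin n₁) (Fin n₂) ℂ) :
    ∫⁻ X, ENNReal.ofReal (Real.exp (-r * ‖M - X‖ ^ 2)) ∂(signalLaw n₁ n₂ s₁ s₂) ≤
      ENNReal.ofReal (s₁.factorial * s₂.factorial / (r / 4) ^ (s₁ + s₂ - 2)) := by
  have := isProbabilityMeasure_sparseUnitLaw hs₁ hsn₁
  have := isProbabilityMeasure_sparseUnitLaw hs₂ hsn₂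
  obtain ⟨a, b, ha, hb, hab⟩ := exists_nearest_outer (hs₁.trans hsn₁) (hs₂.trans hsn₂) M
  have hm : Measurable fun X : Matrix (Fin n₁) (Fin n₂) ℂ =>
      ENNReal.ofReal (Real.exp (-r * ‖M - X‖ ^ 2)) :=
    (((measurable_frobenius_norm_sq (measurable_matrix_sub measurable_const
      measurable_id)).const_mul _).exp).ennreal_ofReal
  have hr4 : 0 < r / 4 := by positivity
  rw [signalLaw, lintegral_map hm measurable_outer]
  calc _ ≤ ∫⁻ p : EuclideanSpace ℂ (Fin n₁) × EuclideanSpace ℂ (Fin n₂),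
        ENNReal.ofReal (Real.exp (-(r / 4) * (1 - ‖(inner ℂ a p.1 : ℂ)‖ ^ 2))) *
          ENNReal.ofReal (Real.exp (-(r / 4) * (1 - ‖(inner ℂ b p.2 : ℂ)‖ ^ 2)))
        ∂((sparseUnitLaw n₁ s₁).prod (sparseUnitLaw n₂ s₂)) := by
        refine lintegral_mono_ae ?_
        filter_upwards [Measure.quasiMeasurePreserving_fst.ae (ae_norm_eq_one_sparseUnitLaw n₁ s₁),
          Measure.quasiMeasurePreserving_snd.ae (ae_norm_eq_one_sparseUnitLaw n₂ s₂)] with p hp hq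
        rw [← ENNReal.ofReal_mul (by positivity), ← Real.exp_add]
        refine ENNReal.ofReal_le_ofReal (Real.exp_le_exp.2 ?_)
        have h1 := le_norm_outer_sub_outer_sq hp ha hq hb
        -- Triangle inequality through `M`, then minimality of `outer a b`; squared, the 2 becomes
        -- the 4 of `r / 4`.
        have h2 : ‖outer p.1 p.2 - outer a b‖ ≤ 2 * ‖M - outer p.1 p.2‖ := by
          have h3 := norm_sub_le_norm_sub_add_norm_sub (outer p.1 p.2) M (outer a b)
          rw [norm_sub_rev M (outer a b)] at h3
          have h4 := hab p.1 p.2 hp hq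
          rw [norm_sub_rev M]
          linarith
        have h5 := pow_le_pow_left₀ (norm_nonneg _) h2 2
        nlinarith
    _ ≤ ENNReal.ofReal (s₁.factorial / (r / 4) ^ (s₁ - 1)) *
          ENNReal.ofReal (s₂.factorial / (r / 4) ^ (s₂ - 1)) := by
        rw [lintegral_prod_mul
          (f := fun u => ENNReal.ofReal (Real.exp (-(r / 4) * (1 - ‖(inner ℂ a u : ℂ)‖ ^ 2))))
          (g := fun v => ENNReal.ofReal (Real.exp (-(r / 4) * (1 - ‖(inner ℂ b v : ℂ)‖ ^ 2))))
          (by fun_prop) (by fun_prop)]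
        exact mul_le_mul' (lintegral_sparseUnitLaw_exp_le hs₁ hsn₁ hr4 a ha.le)
          (lintegral_sparseUnitLaw_exp_le hs₂ hsn₂ hr4 b hb.le)
    _ = _ := by
        rw [← ENNReal.ofReal_mul (by positivity), div_mul_div_comm, ← pow_add]
        congr 4
        omega

/-! ### Complex Gaussian noise: densities, change of measure, energy -/

/-- The density of `CN(0, σ²)`. -/
noncomputable def complexGaussianPDF (σ : ℝ) (z : ℂ) : ℝ :=
  (Real.pi * σ ^ 2)⁻¹ * Real.exp (-(σ ^ 2)⁻¹ * ‖z‖ ^ 2)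

theorem complexGaussianPDF_nonneg (σ : ℝ) (z : ℂ) : 0 ≤ complexGaussianPDF σ z := by
  unfold complexGaussianPDF
  positivity

theorem measurable_complexGaussianPDF (σ : ℝ) : Measurable (complexGaussianPDF σ) := by
  unfold complexGaussianPDF
  fun_prop

theorem integrable_complexGaussianPDF {σ : ℝ} (hσ : 0 < σ) : Integrable (complexGaussianPDF σ) :=
  (integrable_exp_neg_mul_sq_norm_complex (by positivity)).const_mul _

theorem measurable_complex_mk : Measurable fun p : ℝ × ℝ => (⟨p.1, p.2⟩ : ℂ) :=
  Complex.measurableEquivRealProd.symm.measurable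

theorem isProbabilityMeasure_complexGaussian (σ : ℝ) :
    IsProbabilityMeasure (complexGaussian σ) :=
  Measure.isProbabilityMeasure_map measurable_complex_mk.aemeasurable

theorem complexGaussian_eq_withDensity {σ : ℝ} (hσ : 0 < σ) :
    complexGaussian σ = volume.withDensity fun z => ENNReal.ofReal (complexGaussianPDF σ z) := by
  have hv : (σ ^ 2 / 2).toNNReal ≠ 0 := by
    rw [Ne, Real.toNNReal_eq_zero, not_le]
    positivity
  have hmp : MeasurePreserving (fun p : ℝ × ℝ => (⟨p.1, p.2⟩ : ℂ)) volume volume :=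
    Complex.volume_preserving_equiv_real_prod.symm
  ext s hs
  rw [complexGaussian, gaussianReal_of_var_ne_zero _ hv,
    prod_withDensity (measurable_gaussianPDF _ _) (measurable_gaussianPDF _ _),
    Measure.map_apply measurable_complex_mk hs,
    withDensity_apply _ (measurable_complex_mk hs), withDensity_apply _ hs,
    ← hmp.setLIntegral_comp_preimage hs (measurable_complexGaussianPDF σ).ennreal_ofReal]
  refine lintegral_congr fun p => ?_
  rw [gaussianPDF, gaussianPDF, ← ENNReal.ofReal_mul (gaussianPDFReal_nonneg _ _ _)]
  congr 1
  have hσ2 : ((σ ^ 2 / 2).toNNReal : ℝ) = σ ^ 2 / 2 := Real.coe_toNNReal _ (by positivity)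
  rw [gaussianPDFReal, gaussianPDFReal, hσ2, complexGaussianPDF, mul_mul_mul_comm, ← Real.exp_add,
    ← Complex.normSq_eq_norm_sq, Complex.normSq_mk, ← mul_inv,
    Real.mul_self_sqrt (by positivity)]
  congr 2
  · ring
  · field_simp
    ring

theorem pi_complexGaussian {σ : ℝ} (hσ : 0 < σ) (m : ℕ) :
    (Measure.pi fun _ : Fin m => complexGaussian σ) =
      volume.withDensity fun x => ∏ i, ENNReal.ofReal (complexGaussianPDF σ (x i)) := by
  have := isProbabilityMeasure_complexGaussian σ
  refine Measure.pi_eq fun s hs => ?_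
  have hset : MeasurableSet (Set.univ.pi s) := MeasurableSet.univ_pi hs
  have hind : ∀ x : Fin m → ℂ, (Set.univ.pi s).indicator
      (fun x => ∏ i, ENNReal.ofReal (complexGaussianPDF σ (x i))) x =
      ∏ i, ENNReal.ofReal ((s i).indicator (complexGaussianPDF σ) (x i)) := by
    intro x
    by_cases hx : x ∈ Set.univ.pi s
    · rw [Set.indicator_of_mem hx]
      exact Finset.prod_congr rfl fun i _ => by rw [Set.indicator_of_mem (hx i trivial)]
    · rw [Set.indicator_of_notMem hx]
      obtain ⟨i, hi⟩ : ∃ i, x i ∉ s i := by simpa [Set.mem_pi] using hx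
      exact (Finset.prod_eq_zero (Finset.mem_univ i)
        (by rw [Set.indicator_of_notMem hi, ENNReal.ofReal_zero])).symm
  rw [withDensity_apply _ hset, ← lintegral_indicator hset, lintegral_congr hind,
    lintegral_ofReal_prod (f := fun i => (s i).indicator (complexGaussianPDF σ)) (fun i z => Set.indicator_nonneg
      (fun z _ => complexGaussianPDF_nonneg σ z) z)
      (fun i => (integrable_complexGaussianPDF hσ).indicator (hs i))]
  refine Finset.prod_congr rfl fun i _ => ?_
  rw [complexGaussian_eq_withDensity hσ, withDensity_apply _ (hs i), ← lintegral_indicator (hs i)]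
  refine lintegral_congr fun z => ?_
  by_cases hz : z ∈ s i <;> simp [hz]

/-- The density of `CN(0, σ² I_m)`. -/
noncomputable def noisePDF (m : ℕ) (σ : ℝ) (z : EuclideanSpace ℂ (Fin m)) : ℝ :=
  (Real.pi * σ ^ 2)⁻¹ ^ m * Real.exp (-(σ ^ 2)⁻¹ * ‖z‖ ^ 2)

theorem measurable_noisePDF (m : ℕ) (σ : ℝ) : Measurable (noisePDF m σ) := by
  unfold noisePDF
  fun_prop

theorem lintegral_noiseLaw {m : ℕ} {σ : ℝ} (hσ : 0 < σ)
    {F : EuclideanSpace ℂ (Fin m) → ℝ≥0∞} (hF : Measurable F) :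
    ∫⁻ z, F z ∂(noiseLaw m σ) = ∫⁻ x : Fin m → ℂ,
      ENNReal.ofReal (noisePDF m σ (WithLp.toLp 2 x)) * F (WithLp.toLp 2 x) := by
  have hm : Measurable fun x : Fin m → ℂ => ∏ i, ENNReal.ofReal (complexGaussianPDF σ (x i)) :=
    Finset.measurable_prod _ fun i _ =>
      ((measurable_complexGaussianPDF σ).comp (measurable_pi_apply i)).ennreal_ofReal
  rw [noiseLaw, lintegral_map hF (by fun_prop), pi_complexGaussian hσ,
    lintegral_withDensity_eq_lintegral_mul _ hm (g := fun x => F (WithLp.toLp 2 x))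
      (hF.comp (by fun_prop))]
  refine lintegral_congr fun x => ?_
  rw [Pi.mul_apply, ← ENNReal.ofReal_prod_of_nonneg fun i _ => complexGaussianPDF_nonneg σ _]
  congr 2
  simp only [complexGaussianPDF, noisePDF, Finset.prod_mul_distrib, Finset.prod_const,
    Finset.card_univ, Fintype.card_fin, ← Real.exp_sum, ← Finset.mul_sum,
    EuclideanSpace.norm_sq_eq]

theorem isProbabilityMeasure_noiseLaw (m : ℕ) (σ : ℝ) : IsProbabilityMeasure (noiseLaw m σ) := by
  have := isProbabilityMeasure_complexGaussian σ
  exact Measure.isProbabilityMeasure_map (by fun_prop)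

/-- Change of measure between a translated noise law and another noise law. -/
theorem lintegral_noiseLaw_change {m : ℕ} {σ τ : ℝ} (hσ : 0 < σ) (hτ : 0 < τ)
    (w : EuclideanSpace ℂ (Fin m)) {F : EuclideanSpace ℂ (Fin m) → ℝ≥0∞} (hF : Measurable F) :
    ∫⁻ z, ENNReal.ofReal ((σ ^ 2 / τ ^ 2) ^ m *
        Real.exp (‖z‖ ^ 2 / σ ^ 2 - ‖w + z‖ ^ 2 / τ ^ 2)) * F (w + z) ∂(noiseLaw m σ) =
      ∫⁻ y, F y ∂(noiseLaw m τ) := by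
  -- After translating by `w`, the weight is the `τ`-density at `w + z` divided by the `σ`-density
  -- at `z`.
  rw [lintegral_noiseLaw hσ (by fun_prop), lintegral_noiseLaw hτ hF,
    ← lintegral_add_left_eq_self (fun x : Fin m → ℂ =>
      ENNReal.ofReal (noisePDF m τ (WithLp.toLp 2 x)) * F (WithLp.toLp 2 x)) (WithLp.ofLp w)]
  refine lintegral_congr fun x => ?_
  rw [← mul_assoc, ← ENNReal.ofReal_mul (by unfold noisePDF; positivity), WithLp.toLp_add,
    WithLp.toLp_ofLp]
  congr 2
  simp only [noisePDF]
  rw [mul_mul_mul_comm, ← mul_pow, ← Real.exp_add]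
  congr 2
  · field_simp
  · field_simp
    ring

theorem lintegral_noiseLaw_neg {m : ℕ} {σ : ℝ} (hσ : 0 < σ)
    {F : EuclideanSpace ℂ (Fin m) → ℝ≥0∞} (hF : Measurable F) :
    ∫⁻ z, F (-z) ∂(noiseLaw m σ) = ∫⁻ z, F z ∂(noiseLaw m σ) := by
  rw [lintegral_noiseLaw hσ (by fun_prop), lintegral_noiseLaw hσ hF,
    ← (Measure.measurePreserving_neg (volume : Measure (Fin m → ℂ))).lintegral_comp (by
      have := measurable_noisePDF m σ
      fun_prop)]
  refine lintegral_congr fun x => ?_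
  simp [noisePDF]

theorem lintegral_sq_gaussianReal (v : NNReal) :
    ∫⁻ x, ENNReal.ofReal (x ^ 2) ∂(gaussianReal 0 v) = v := by
  have h2 : MemLp id 2 (gaussianReal 0 v) := memLp_id_gaussianReal 2
  have h := variance_id_gaussianReal (μ := 0) (v := v)
  rw [variance_of_integral_eq_zero aemeasurable_id (by simp)] at h
  have hi : Integrable (fun x : ℝ => x ^ 2) (gaussianReal 0 v) := h2.integrable_sq
  rw [← ofReal_integral_eq_lintegral_ofReal hi (.of_forall fun x => sq_nonneg x)]
  simp only [id] at h
  rw [h, ENNReal.ofReal_coe_nnreal]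

theorem lintegral_norm_sq_complexGaussian (σ : ℝ) :
    ∫⁻ z, ENNReal.ofReal (‖z‖ ^ 2) ∂(complexGaussian σ) = ENNReal.ofReal (σ ^ 2) := by
  rw [complexGaussian, lintegral_map (by fun_prop) measurable_complex_mk]
  have : ∀ p : ℝ × ℝ, ENNReal.ofReal (‖(⟨p.1, p.2⟩ : ℂ)‖ ^ 2) =
      ENNReal.ofReal (p.1 ^ 2) + ENNReal.ofReal (p.2 ^ 2) := by
    intro p
    rw [← Complex.normSq_eq_norm_sq, Complex.normSq_mk,
      ← ENNReal.ofReal_add (by positivity) (by positivity), sq, sq]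
  simp_rw [this]
  set γ := gaussianReal 0 (σ ^ 2 / 2).toNNReal
  have hq : Measurable fun x : ℝ => ENNReal.ofReal (x ^ 2) := by fun_prop
  have h1 : ∫⁻ p : ℝ × ℝ, ENNReal.ofReal (p.1 ^ 2) ∂(γ.prod γ) = _ :=
    measurePreserving_fst.lintegral_comp hq
  have h2 : ∫⁻ p : ℝ × ℝ, ENNReal.ofReal (p.2 ^ 2) ∂(γ.prod γ) = _ :=
    measurePreserving_snd.lintegral_comp hq
  rw [lintegral_add_left (by fun_prop), h1, h2, lintegral_sq_gaussianReal]
  change ENNReal.ofReal (σ ^ 2 / 2) + ENNReal.ofReal (σ ^ 2 / 2) = _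
  rw [← ENNReal.ofReal_add (by positivity) (by positivity), add_halves]

theorem lintegral_norm_sq_noiseLaw (m : ℕ) (σ : ℝ) :
    ∫⁻ z, ENNReal.ofReal (‖z‖ ^ 2) ∂(noiseLaw m σ) = ENNReal.ofReal (m * σ ^ 2) := by
  have := isProbabilityMeasure_complexGaussian σ
  rw [noiseLaw, lintegral_map (by fun_prop) (by fun_prop)]
  have : ∀ x : Fin m → ℂ, ENNReal.ofReal (‖(WithLp.toLp 2 x : EuclideanSpace ℂ (Fin m))‖ ^ 2) =
      ∑ i, ENNReal.ofReal (‖x i‖ ^ 2) := by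
    intro x
    rw [EuclideanSpace.norm_sq_eq, ENNReal.ofReal_sum_of_nonneg fun i _ => by positivity]
  simp_rw [this]
  rw [lintegral_finsetSum _ fun i _ => by fun_prop]
  have h : ∀ i : Fin m, ∫⁻ x, ENNReal.ofReal (‖x i‖ ^ 2)
      ∂(Measure.pi fun _ : Fin m => complexGaussian σ) = ENNReal.ofReal (σ ^ 2) := fun i => by
    rw [(measurePreserving_eval (fun _ : Fin m => complexGaussian σ) i).lintegral_comp
      (f := fun z => ENNReal.ofReal (‖z‖ ^ 2)) (by fun_prop), lintegral_norm_sq_complexGaussian]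
  simp_rw [h]
  rw [Finset.sum_const, Finset.card_univ, Fintype.card_fin, nsmul_eq_mul,
    ENNReal.ofReal_mul (by positivity), ENNReal.ofReal_natCast]

/-- The cross term vanishes because the noise is symmetric: average over `z` and `-z` and apply the
parallelogram law. -/
theorem lintegral_norm_add_sq_noiseLaw {m : ℕ} {σ : ℝ} (hσ : 0 < σ)
    (w : EuclideanSpace ℂ (Fin m)) :
    ∫⁻ z, ENNReal.ofReal (‖w + z‖ ^ 2) ∂(noiseLaw m σ) =
      ENNReal.ofReal (‖w‖ ^ 2) + ENNReal.ofReal (m * σ ^ 2) := by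
  have := isProbabilityMeasure_noiseLaw m σ
  have h1 := lintegral_noiseLaw_neg hσ (F := fun z => ENNReal.ofReal (‖w + z‖ ^ 2)) (by fun_prop)
  have h2 : (2 : ℝ≥0∞) * ∫⁻ z, ENNReal.ofReal (‖w + z‖ ^ 2) ∂(noiseLaw m σ) =
      2 * (ENNReal.ofReal (‖w‖ ^ 2) + ENNReal.ofReal (m * σ ^ 2)) := by
    calc _ = ∫⁻ z, ENNReal.ofReal (‖w + z‖ ^ 2) + ENNReal.ofReal (‖w + -z‖ ^ 2)
          ∂(noiseLaw m σ) := by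
          rw [lintegral_add_left (by fun_prop), h1, two_mul]
      _ = ∫⁻ z, 2 * (ENNReal.ofReal (‖w‖ ^ 2) + ENNReal.ofReal (‖z‖ ^ 2)) ∂(noiseLaw m σ) := by
          refine lintegral_congr fun z => ?_
          have h := parallelogram_law_with_norm ℂ w z
          rw [← ENNReal.ofReal_add (by positivity) (by positivity),
            ← ENNReal.ofReal_add (by positivity) (by positivity),
            two_mul, ← ENNReal.ofReal_add (by positivity) (by positivity), ← sub_eq_add_neg]
          congr 1
          nlinarith
      _ = _ := by
          rw [lintegral_const_mul _ (by fun_prop), lintegral_add_left (by fun_prop),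
            lintegral_norm_sq_noiseLaw]
          simp
  exact (ENNReal.mul_right_inj two_ne_zero (by simp)).1 h2

/-! ### The rate-distortion converse -/

theorem integrable_and_integral_le {α : Type*} [MeasurableSpace α] {P : Measure α} {h : α → ℝ}
    (hm : Measurable h) (h0 : ∀ x, 0 ≤ h x) {c : ℝ} (hc : 0 ≤ c)
    (hle : ∫⁻ x, ENNReal.ofReal (h x) ∂P ≤ ENNReal.ofReal c) :
    Integrable h P ∧ ∫ x, h x ∂P ≤ c := by
  have hi : Integrable h P := by
    refine ⟨hm.aestronglyMeasurable, ?_⟩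
    rw [hasFiniteIntegral_iff_ofReal (.of_forall h0)]
    exact hle.trans_lt ENNReal.ofReal_lt_top
  refine ⟨hi, ?_⟩
  rwa [← ofReal_integral_eq_lintegral_ofReal hi (.of_forall h0),
    ENNReal.ofReal_le_ofReal_iff hc] at hle

theorem enorm_sq_eq_ofReal {E : Type*} [SeminormedAddCommGroup E] (x : E) :
    ‖x‖ₑ ^ 2 = ENNReal.ofReal (‖x‖ ^ 2) := by
  rw [ENNReal.ofReal_pow (norm_nonneg _), ofReal_norm]

/-- Replacing the channel by an output which is independent of the signal. -/
theorem lintegral_likelihood_mul_le {α : Type*} [MeasurableSpace α] (Q : Measure α)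
    [IsProbabilityMeasure Q] {m : ℕ} {σ τ : ℝ} (hσ : 0 < σ) (hτ : 0 < τ)
    {f : α → EuclideanSpace ℂ (Fin m)} (hf : Measurable f)
    {K : α × EuclideanSpace ℂ (Fin m) → ℝ≥0∞} (hK : Measurable K) {B : ℝ≥0∞}
    (hB : ∀ y, ∫⁻ X, K (X, y) ∂Q ≤ B) :
    ∫⁻ p, ENNReal.ofReal ((σ ^ 2 / τ ^ 2) ^ m *
        Real.exp (‖p.2‖ ^ 2 / σ ^ 2 - ‖f p.1 + p.2‖ ^ 2 / τ ^ 2)) * K (p.1, f p.1 + p.2)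
        ∂(Q.prod (noiseLaw m σ)) ≤ B := by
  have := isProbabilityMeasure_noiseLaw m σ
  have := isProbabilityMeasure_noiseLaw m τ
  rw [lintegral_prod _ (by fun_prop)]
  have h : ∀ X, ∫⁻ z, ENNReal.ofReal ((σ ^ 2 / τ ^ 2) ^ m *
      Real.exp (‖z‖ ^ 2 / σ ^ 2 - ‖f X + z‖ ^ 2 / τ ^ 2)) * K (X, f X + z) ∂(noiseLaw m σ) =
      ∫⁻ y, K (X, y) ∂(noiseLaw m τ) := fun X =>
    lintegral_noiseLaw_change hσ hτ (f X) (F := fun y => K (X, y)) (by fun_prop)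
  simp_rw [h]
  -- Signal and output are now independent, so `X` can be averaged first at fixed `y`.
  rw [lintegral_lintegral_swap (f := fun X y => K (X, y)) hK.aemeasurable]
  refine (lintegral_mono hB).trans_eq ?_
  rw [lintegral_const, measure_univ, mul_one]

/-- The rate–distortion converse, in dual form: the capacity of the channel dominates the Shannon
lower bound at slope `r`. -/
theorem capacity_ge {n₁ n₂ s₁ s₂ m : ℕ}
    (hs₁ : 1 ≤ s₁) (hsn₁ : s₁ ≤ n₁) (hs₂ : 1 ≤ s₂) (hsn₂ : s₂ ≤ n₂)
    {σ D r : ℝ} (hσ : 0 < σ) (hD : 0 ≤ D) (hr : 0 < r)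
    {f : Matrix (Fin n₁) (Fin n₂) ℂ → EuclideanSpace ℂ (Fin m)}
    {g : EuclideanSpace ℂ (Fin m) → Matrix (Fin n₁) (Fin n₂) ℂ}
    (hf : Measurable f) (hg : Measurable g)
    (hpow : avgPower s₁ s₂ f ≤ (m : ℝ≥0∞))
    (herr : meanSqError s₁ s₂ σ f g ≤ ENNReal.ofReal D) :
    -r * D - Real.log (s₁.factorial * s₂.factorial / (r / 4) ^ (s₁ + s₂ - 2)) ≤
      m * Real.log (1 + 1 / σ ^ 2) := by
  have := isProbabilityMeasure_signalLaw hs₁ hsn₁ hs₂ hsn₂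
  have := isProbabilityMeasure_noiseLaw m σ
  -- The power constraint bounds the output energy by mτ². Hence N/σ² has mean m and R/τ² mean at
  -- most m.
  set τ := Real.sqrt (1 + σ ^ 2) with hτ
  have hτ0 : 0 < τ := by positivity
  have hτ2 : τ ^ 2 = 1 + σ ^ 2 := Real.sq_sqrt (by positivity)
  have := isProbabilityMeasure_noiseLaw m τ
  set Q := signalLaw n₁ n₂ s₁ s₂ with hQ
  set P := Q.prod (noiseLaw m σ) with hP
  set B : ℝ := s₁.factorial * s₂.factorial / (r / 4) ^ (s₁ + s₂ - 2) with hB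
  have hB0 : 0 < B := by positivity
  set L := Real.log (σ ^ 2 / τ ^ 2) with hL
  have hLσ : L = -Real.log (1 + 1 / σ ^ 2) := by
    rw [hL, hτ2, ← Real.log_inv]
    congr 1
    field_simp
    ring
  -- the squared error, the noise energy, the output energy and the tilted likelihood ratio
  let A : Matrix (Fin n₁) (Fin n₂) ℂ × EuclideanSpace ℂ (Fin m) → ℝ :=
    fun p => ‖g (f p.1 + p.2) - p.1‖ ^ 2
  let N : Matrix (Fin n₁) (Fin n₂) ℂ × EuclideanSpace ℂ (Fin m) → ℝ := fun p => ‖p.2‖ ^ 2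
  let R : Matrix (Fin n₁) (Fin n₂) ℂ × EuclideanSpace ℂ (Fin m) → ℝ := fun p => ‖f p.1 + p.2‖ ^ 2
  let E : Matrix (Fin n₁) (Fin n₂) ℂ × EuclideanSpace ℂ (Fin m) → ℝ := fun p =>
    (σ ^ 2 / τ ^ 2) ^ m * Real.exp (N p / σ ^ 2 - R p / τ ^ 2) * Real.exp (-r * A p)
  have hAm : Measurable A :=
    measurable_frobenius_norm_sq (measurable_matrix_sub (by fun_prop) measurable_fst)
  have hNm : Measurable N := by fun_prop
  have hRm : Measurable R := by fun_prop
  have hEm : Measurable E := by fun_prop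
  have hAi : Integrable A P ∧ ∫ p, A p ∂P ≤ D := by
    refine integrable_and_integral_le hAm (fun p => by positivity) hD ?_
    simp_rw [A, ← enorm_sq_eq_ofReal]
    exact herr
  have hNl : ∫⁻ p, ENNReal.ofReal (N p) ∂P = ENNReal.ofReal (m * σ ^ 2) := by
    rw [← lintegral_norm_sq_noiseLaw m σ]
    exact measurePreserving_snd.lintegral_comp
      (f := fun z : EuclideanSpace ℂ (Fin m) => ENNReal.ofReal (‖z‖ ^ 2)) (by fun_prop)
  have hNi : Integrable N P :=
    (integrable_and_integral_le hNm (fun p => by positivity) (by positivity) hNl.le).1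
  have hN : ∫ p, N p ∂P = m * σ ^ 2 := by
    rw [← ofReal_integral_eq_lintegral_ofReal hNi (.of_forall fun p => by positivity)] at hNl
    exact (ENNReal.ofReal_eq_ofReal_iff (integral_nonneg fun p => by positivity)
      (by positivity)).1 hNl
  have hRi : Integrable R P ∧ ∫ p, R p ∂P ≤ m * τ ^ 2 := by
    refine integrable_and_integral_le hRm (fun p => by positivity) (by positivity) ?_
    rw [hP, lintegral_prod _ (by fun_prop)]
    simp_rw [R, lintegral_norm_add_sq_noiseLaw hσ]
    rw [lintegral_add_right _ measurable_const, lintegral_const, measure_univ, mul_one, hτ2,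
      mul_add, mul_one, ENNReal.ofReal_add (by positivity) (by positivity), ENNReal.ofReal_natCast]
    gcongr
    simp_rw [← enorm_sq_eq_ofReal]
    exact hpow
  have hEi : Integrable E P ∧ ∫ p, E p ∂P ≤ B := by
    refine integrable_and_integral_le hEm (fun p => by positivity) hB0.le ?_
    have hK : Measurable fun q : Matrix (Fin n₁) (Fin n₂) ℂ × EuclideanSpace ℂ (Fin m) =>
        ENNReal.ofReal (Real.exp (-r * ‖g q.2 - q.1‖ ^ 2)) :=
      ((measurable_frobenius_norm_sq (measurable_matrix_sub (hg.comp measurable_snd)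
        measurable_fst)).const_mul _).exp.ennreal_ofReal
    refine (lintegral_congr fun p => ?_).trans_le (lintegral_likelihood_mul_le Q hσ hτ0 hf hK
      fun y => lintegral_signalLaw_exp_le hs₁ hsn₁ hs₂ hsn₂ hr (g y))
    rw [← ENNReal.ofReal_mul (by positivity)]
  -- This is log t ≤ t - 1 at t = E/B. After integration the right side is at most 1 and cancels the
  -- 1 on the left.
  have hpt : ∀ p, m * L + (N p / σ ^ 2 - R p / τ ^ 2) - r * A p - Real.log B + 1 ≤ E p / B := by
    intro p
    have hE0 : 0 < E p := by positivity
    have h := Real.log_le_sub_one_of_pos (div_pos hE0 hB0)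
    have hlog : Real.log (E p) = m * L + (N p / σ ^ 2 - R p / τ ^ 2) + -r * A p := by
      rw [Real.log_mul (by positivity) (by positivity), Real.log_mul (by positivity) (by positivity),
        Real.log_pow, Real.log_exp, Real.log_exp]
    rw [Real.log_div hE0.ne' hB0.ne', hlog] at h
    linarith
  have hNR : Integrable (fun p => N p / σ ^ 2 - R p / τ ^ 2) P :=
    (hNi.div_const _).sub (hRi.1.div_const _)
  have h1 : Integrable (fun p => m * L + (N p / σ ^ 2 - R p / τ ^ 2)) P :=
    (integrable_const _).add hNR
  have h2 : Integrable (fun p => m * L + (N p / σ ^ 2 - R p / τ ^ 2) - r * A p) P :=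
    h1.sub (hAi.1.const_mul r)
  have h3 : Integrable (fun p => m * L + (N p / σ ^ 2 - R p / τ ^ 2) - r * A p - Real.log B) P :=
    h2.sub (integrable_const _)
  have hint : ∫ p, (m * L + (N p / σ ^ 2 - R p / τ ^ 2) - r * A p - Real.log B + 1) ∂P ≤
      ∫ p, E p / B ∂P := by
    refine integral_mono ?_ (hEi.1.div_const B) hpt
    exact h3.add (integrable_const _)
  rw [integral_add h3 (integrable_const _), integral_sub h2 (integrable_const _),
    integral_sub h1 (hAi.1.const_mul r), integral_add (integrable_const _) hNR,
    integral_sub (hNi.div_const _) (hRi.1.div_const _), integral_div, integral_div, integral_div,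
    hN] at hint
  simp only [integral_const, probReal_univ, one_smul] at hint
  have e0 : ∫ p, r * A p ∂P = r * ∫ p, A p ∂P := integral_const_mul _ _
  have e1 : (m * σ ^ 2 : ℝ) / σ ^ 2 = m := by field_simp
  have e2 : (∫ p, R p ∂P) / τ ^ 2 ≤ m := (div_le_iff₀ (by positivity)).2 hRi.2
  have e3 : (∫ p, E p ∂P) / B ≤ 1 := (div_le_one hB0).2 hEi.2
  have e4 := mul_le_mul_of_nonneg_left hAi.2 hr.le
  rw [e0, e1, hLσ] at hint
  linarith

/-! ### Explicit constants and the low-noise limit -/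

/-- With k = s₁ + s₂ - 2, (s₁-1)!(s₂-1)! ≤ k! ≤ k^k. The leftover log s₁ + log s₂ is absorbed by the
slack k(log 3 - 1), positive since 3 > e, and the constant 7. -/
theorem log_factorial_mul_factorial_le {s₁ s₂ : ℕ} (hs₁ : 1 ≤ s₁) (hs₂ : 1 ≤ s₂)
    (hk : 1 ≤ s₁ + s₂ - 2) :
    Real.log (s₁.factorial * s₂.factorial) ≤ (s₁ + s₂ - 2 : ℕ) * Real.log (s₁ + s₂ - 2 : ℕ) +
      (s₁ + s₂ - 2 : ℕ) * (Real.log 3 - 1) + 7 := by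
  -- Tangent of log at 20, whose slope 1/20 lies below log 3 - 1; log 20 ≤ 3 gives the constant.
  have hlog : ∀ s : ℕ, 1 ≤ s → Real.log s ≤ s / 20 + 2 := by
    intro s hs
    have h20 : Real.log 20 ≤ 3 := by
      rw [Real.log_le_iff_le_exp (by norm_num)]
      have := Real.exp_one_gt_d9
      calc (20 : ℝ) ≤ 2.7182818283 ^ 3 := by norm_num
        _ ≤ Real.exp 1 ^ 3 := by gcongr
        _ = Real.exp 3 := by rw [← Real.exp_nat_mul]; norm_num
    have hs' : (0 : ℝ) < s := by exact_mod_cast hs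
    have h := Real.log_le_sub_one_of_pos (div_pos hs' (show (0 : ℝ) < 20 by norm_num))
    rw [Real.log_div hs'.ne' (by norm_num)] at h
    linarith
  obtain ⟨a, rfl⟩ : ∃ a, s₁ = a + 1 := ⟨s₁ - 1, by omega⟩
  obtain ⟨b, rfl⟩ : ∃ b, s₂ = b + 1 := ⟨s₂ - 1, by omega⟩
  have hab : a + 1 + (b + 1) - 2 = a + b := by omega
  rw [hab] at hk ⊢
  have hfac : a.factorial * b.factorial ≤ (a + b) ^ (a + b) :=
    (Nat.le_of_dvd (Nat.factorial_pos _) (Nat.factorial_mul_factorial_dvd_factorial_add a b)).trans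
      (Nat.factorial_le_pow _)
  have hle : Real.log (a.factorial * b.factorial) ≤ (a + b : ℕ) * Real.log (a + b : ℕ) := by
    rw [← Real.log_pow]
    exact Real.log_le_log (by positivity) (by exact_mod_cast hfac)
  have h3 := Real.log_three_gt_d9
  have ha := hlog (a + 1) (by omega)
  have hb := hlog (b + 1) (by omega)
  have hsplit : Real.log ((a + 1).factorial * (b + 1).factorial) =
      Real.log (a + 1 : ℕ) + Real.log (b + 1 : ℕ) + Real.log (a.factorial * b.factorial) := by
    rw [← Real.log_mul (by positivity) (by positivity), ← Real.log_mul (by positivity) (by positivity),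
      Nat.factorial_succ, Nat.factorial_succ]
    congr 1
    push_cast
    ring
  rw [hsplit]
  have hk0 : (0 : ℝ) ≤ (a + b : ℕ) := by positivity
  have h5 : ((a + b : ℕ) : ℝ) * (1 / 20) ≤ (a + b : ℕ) * (Real.log 3 - 1) := by
    gcongr
    linarith
  push_cast at *
  linarith

/-- Valid for every `D > 0`, so it applies to `C * σ ^ 2` with no smallness condition. In the
constant 12 = 4 · 3, the 4 comes from `r / 4` and the 3 pays for the factorials. -/
theorem distortion_bound {n₁ n₂ s₁ s₂ m : ℕ}
    (hs₁ : 1 ≤ s₁) (hsn₁ : s₁ ≤ n₁) (hs₂ : 1 ≤ s₂) (hsn₂ : s₂ ≤ n₂)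
    {σ D : ℝ} (hσ : 0 < σ) (hD : 0 < D)
    {f : Matrix (Fin n₁) (Fin n₂) ℂ → EuclideanSpace ℂ (Fin m)}
    {g : EuclideanSpace ℂ (Fin m) → Matrix (Fin n₁) (Fin n₂) ℂ}
    (hf : Measurable f) (hg : Measurable g)
    (hpow : avgPower s₁ s₂ f ≤ (m : ℝ≥0∞))
    (herr : meanSqError s₁ s₂ σ f g ≤ ENNReal.ofReal D) :
    ((s₁ : ℝ) + s₂ - 2) * Real.log (1 / (12 * D)) - 7 ≤ m * Real.log (1 + 1 / σ ^ 2) := by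
  have hcast : ((s₁ : ℝ) + s₂ - 2) = (s₁ + s₂ - 2 : ℕ) := by
    rw [Nat.cast_sub (by omega)]
    push_cast
    rfl
  rw [hcast]
  rcases Nat.eq_zero_or_pos (s₁ + s₂ - 2) with hk | hk
  · have : 0 ≤ Real.log (1 + 1 / σ ^ 2) :=
      Real.log_nonneg (le_add_of_nonneg_right (by positivity))
    rw [hk, Nat.cast_zero, zero_mul]
    have := mul_nonneg (Nat.cast_nonneg (α := ℝ) m) this
    linarith
  · have hfac := log_factorial_mul_factorial_le hs₁ hs₂ hk
    set k := s₁ + s₂ - 2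
    have hk0 : (0 : ℝ) < k := by exact_mod_cast hk
    -- The slope r = k/D maximizes -rD + k log r; it is positive because k = 0 was treated apart.
    have h := capacity_ge hs₁ hsn₁ hs₂ hsn₂ hσ hD.le (div_pos hk0 hD) hf hg hpow herr
    rw [Real.log_div (by positivity) (by positivity), Real.log_pow] at h
    have e1 : -(k / D) * D = -(k : ℝ) := by field_simp
    have e2 : Real.log (k / D / 4) = Real.log k + Real.log 3 + Real.log (1 / (12 * D)) := by
      rw [← Real.log_mul (by positivity) (by positivity),
        ← Real.log_mul (by positivity) (by positivity)]
      congr 1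
      field_simp
      norm_num
    rw [e1, e2] at h
    linarith

end SparseRankOne

theorem mainTheorem5 (n₁ n₂ s₁ s₂ m : ℕ)
    (hs₁ : 1 ≤ s₁) (hsn₁ : s₁ ≤ n₁) (hs₂ : 1 ≤ s₂) (hsn₂ : s₂ ≤ n₂) :
    (∀ σ D : ℝ, 0 < σ → 0 < D → D < 1 / 12 →
      ∀ (f : Matrix (Fin n₁) (Fin n₂) ℂ → EuclideanSpace ℂ (Fin m))
        (g : EuclideanSpace ℂ (Fin m) → Matrix (Fin n₁) (Fin n₂) ℂ),
        Measurable f → Measurable g →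
        SparseRankOne.avgPower s₁ s₂ f ≤ (m : ℝ≥0∞) →
        SparseRankOne.meanSqError s₁ s₂ σ f g ≤ ENNReal.ofReal D →
        (((s₁ : ℝ) + (s₂ : ℝ) - 2) * Real.log (1 / (12 * D)) - 7) / Real.log (1 + 1 / σ ^ 2)
          ≤ (m : ℝ)) ∧
    ((∃ C : ℝ, ∀ σ : ℝ, 0 < σ →
      ∃ (f : Matrix (Fin n₁) (Fin n₂) ℂ → EuclideanSpace ℂ (Fin m))
        (g : EuclideanSpace ℂ (Fin m) → Matrix (Fin n₁) (Fin n₂) ℂ),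
        Measurable f ∧ Measurable g ∧
        SparseRankOne.avgPower s₁ s₂ f ≤ (m : ℝ≥0∞) ∧
        SparseRankOne.meanSqError s₁ s₂ σ f g ≤ ENNReal.ofReal (C * σ ^ 2)) →
      (s₁ : ℝ) + (s₂ : ℝ) - 2 ≤ (m : ℝ)) := by
  constructor
  · intro σ D hσ hD _ f g hf hg hpow herr
    have hlog : 0 < Real.log (1 + 1 / σ ^ 2) :=
      Real.log_pos (lt_add_of_pos_right _ (by positivity))
    rw [div_le_iff₀ hlog]
    exact SparseRankOne.distortion_bound hs₁ hsn₁ hs₂ hsn₂ hσ hD hf hg hpow herr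
  · rintro ⟨C, hC⟩
    by_contra! hlt
    set k : ℝ := (s₁ : ℝ) + (s₂ : ℝ) - 2 with hk
    -- `C` may be nonpositive, while the distortion bound needs a positive distortion.
    set C' := max C 1 with hC'
    have hC0 : 0 < C' := lt_max_of_lt_right one_pos
    -- The bound will read k(c - log(12C')) - 7 ≤ m(log 2 + c). This `c` is just past the value
    -- where that fails; the maximum with 0 keeps it positive.
    set c : ℝ := max 0 ((m * Real.log 2 + k * Real.log (12 * C') + 7) / (k - m)) + 1 with hc
    have hc0 : 0 < c := by positivity
    have hkm : 0 < k - m := sub_pos.2 hlt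
    -- the noise level with `log (1 / σ ^ 2) = c`
    set σ : ℝ := Real.exp (-c / 2) with hσ
    have hσ0 : 0 < σ := Real.exp_pos _
    have hσ2 : σ ^ 2 = Real.exp (-c) := by
      rw [hσ, ← Real.exp_nat_mul]
      congr 1
      push_cast
      ring
    have hinv : 1 / σ ^ 2 = Real.exp c := by rw [hσ2, one_div, ← Real.exp_neg, neg_neg]
    obtain ⟨f, g, hf, hg, hpow, herr⟩ := hC σ hσ0
    have h := SparseRankOne.distortion_bound hs₁ hsn₁ hs₂ hsn₂ hσ0
      (mul_pos hC0 (pow_pos hσ0 2)) hf hg hpow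
      (herr.trans (ENNReal.ofReal_le_ofReal
        (mul_le_mul_of_nonneg_right (le_max_left C 1) (sq_nonneg σ))))
    have e1 : Real.log (1 / (12 * (C' * σ ^ 2))) = c - Real.log (12 * C') := by
      rw [← mul_assoc, one_div, Real.log_inv, Real.log_mul (by positivity) (by positivity), hσ2,
        Real.log_exp]
      ring
    have e2 : Real.log (1 + 1 / σ ^ 2) ≤ Real.log 2 + c := by
      rw [hinv, ← Real.log_exp c, ← Real.log_mul two_ne_zero (Real.exp_pos _).ne', Real.log_exp]
      refine Real.log_le_log (by positivity) ?_
      have := Real.one_le_exp hc0.le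
      linarith
    have e3 : (m * Real.log 2 + k * Real.log (12 * C') + 7) < c * (k - m) := by
      rw [← div_lt_iff₀ hkm]
      exact (le_max_right 0 _).trans_lt (lt_add_one _)
    have e4 := mul_le_mul_of_nonneg_left e2 (Nat.cast_nonneg (α := ℝ) m)
    rw [e1] at h
    nlinarith
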